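/- Let $\mathbb{N}=\{1,2,3,\dots\}$; for $A\subseteq\mathbb{N}$ and $n\in\mathbb{N}$ put $A-n=\{m\in\mathbb{N} : m+n\in A\}$. A set $A\subseteq\mathbb{N}$ is thick if for every finite $F\subseteq\mathbb{N}$ there is $n\in\mathbb{N}$ with $F+n\subseteq A$, and piecewise syndetic if $A\cup(A-1)\cup\dots\cup(A-N)$ is thick for some $N\in\mathbb{N}$. A minimal system $(X,T)$ is a nonempty compact metric space $X$ with a continuous map $T:X\to X$ such that the only nonempty closed $Y\subseteq X$ with $TY\subseteq Y$ is $Y=X$. For $x \in X$ and $U\subseteq X$ let $R(x,U)=\{n\in\mathbb{N} : T^nx\in U\}$. A set $A\subseteq\mathbb{N}$ is - dynamically thick if $A\cap R(x,U)\neq\emptyset$ for all minimal systems $(X,T)$, all $x\in X$ and all nonempty open $U\subseteq X$; - a set of pointwise recurrence if $A\cap R(x,U)\neq\emptyset$ for all minimal systems $(X,T)$, all $x\in X$ and all open $U\subseteq X$ with $x\in U$; - dynamically syndetic if $A\supseteq R(x,U)$ for some minimal system $(X,T)$, some $x\in X$ and some nonempty open $U\subseteq X$; - dynamically central syndetic if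 $A\supseteq R(x,U)$ for some minimal system $(X,T)$, some $x\in X$ and some open $U\subseteq X$ with $x\in U$; - dynamically central piecewise syndetic if $A=B\cap C$ with $B$ dynamically central syndetic and $C$ a set of pointwise recurrence. Denote by $d\mathcal{T}$, $dc\mathcal{T}$, $d\mathcal{S}$, $dc\mathcal{S}$, $dc\mathcal{PS}$ these five families (in this order), and by $\mathcal{PS}$ the family of piecewise syndetic sets; for a family $\mathscr{F}$ let $\mathscr{F}^*$ be the family of all sets $B\subseteq\mathbb{N}$ with $B\cap A\neq\emptyset$ for every $A\in\mathscr{F}$. Theorem. (I) Let $A,B\subseteq\mathbb{N}$. If the symmetric difference $A\triangle B$ is not piecewise syndetic, then $A$ is a set of pointwise recurrence if and only if $B$ is. The same is true with "set of pointwise recurrence" replaced by "dynamically thick", "dynamically syndetic" and "dynamically central syndetic". (II) Let $E\subseteq\mathbb{N}$. Each of the following conditions is equivalent to $E$ being not piecewise syndetic: 1. for all $A\in d\mathcal{S}$, $A\setminus E\in d\mathcal{S}$; 2. for all $A\in d\mathcal{T}$, $A\setminus E\in d\mathcal{T}$; 3. for all $A\in\mathcal{PS}$, $A\setminus E\in\mathcal{PS}$;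 4. for all $A\in\mathcal{PS}^*$, $A\setminus E\in\mathcal{PS}^*$. Moreover, if $E$ is not piecewise syndetic, then 5. for all $A\in dc\mathcal{S}$, $A\setminus E\in dc\mathcal{S}$; 6. for all $A\in dc\mathcal{T}$, $A\setminus E\in dc\mathcal{T}$; 7. for all $A\in dc\mathcal{PS}$, $A\setminus E\in dc\mathcal{PS}$; 8. for all $A\in dc\mathcal{PS}^*$, $A\setminus E\in dc\mathcal{PS}^*$. -/

import Mathlib

/-! Families of subsets of the positive integers `ℕ+`. -/

namespace Recurrence

/-- `A - n = {m ∈ ℕ+ | m + n ∈ A}`. -/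
def shift (A : Set ℕ+) (n : ℕ+) : Set ℕ+ := {m | m + n ∈ A}

/-- `A` is thick: for every finite `F` there is `n` with `F + n ⊆ A`. -/
def IsThick (A : Set ℕ+) : Prop :=
  ∀ F : Finset ℕ+, ∃ n : ℕ+, ∀ f ∈ F, f + n ∈ A

/-- `A` is piecewise syndetic: for some `N`, the set
`A ∪ (A - 1) ∪ ⋯ ∪ (A - N)` is thick. -/
def IsPiecewiseSyndetic (A : Set ℕ+) : Prop :=
  ∃ N : ℕ+, IsThick (A ∪ ⋃ n ∈ Set.Icc 1 N, shift A n)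

/-- The system `(X, T)` is minimal: `T` is continuous and the only nonempty, closed,
`T`-invariant subset is the whole space. (Compactness, metrizability and non-emptiness of `X` are
required where systems are quantified over.) -/
def IsMinimalSystem {X : Type} [TopologicalSpace X] (T : X → X) : Prop :=
  Continuous T ∧
    ∀ Y : Set X, Y.Nonempty → IsClosed Y → T '' Y ⊆ Y → Y = Set.univ

/-- `R(x, U) = {n ∈ ℕ+ | T^n x ∈ U}`. -/
def returnTimes {X : Type} (T : X → X) (x : X) (U : Set X) : Set ℕ+ :=
  {n | T^[(n : ℕ)] x ∈ U}

/-- `A` is a set of pointwise recurrence: in every minimal system, every point `x` visits each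
of its open neighbourhoods at some time in `A`. (Every compact metric space is homeomorphic to a
closed subset of the Hilbert cube, so there is no loss in letting `X` range over `Type`.) -/
def IsPointwiseRecurrence (A : Set ℕ+) : Prop :=
  ∀ (X : Type) [MetricSpace X] [CompactSpace X] [Nonempty X] (T : X → X),
    IsMinimalSystem T → ∀ (x : X) (U : Set X), IsOpen U → x ∈ U →
      ∃ n ∈ A, T^[(n : ℕ)] x ∈ U

/-- `A` is dynamically thick: in every minimal system, every point `x` visits every nonempty
open set at some time in `A`. -/
def IsDynamicallyThick (A : Set ℕ+) : Prop :=
  ∀ (X : Type) [MetricSpace X] [CompactSpace X] [Nonempty X] (T : X → X),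
    IsMinimalSystem T → ∀ (x : X) (U : Set X), IsOpen U → U.Nonempty →
      ∃ n ∈ A, T^[(n : ℕ)] x ∈ U

/-- `A` is dynamically syndetic: it contains some `R(x, U)`, where `(X, T)` is a minimal system,
`x ∈ X` and `U ⊆ X` is open and nonempty. -/
def IsDynamicallySyndetic (A : Set ℕ+) : Prop :=
  ∃ (X : Type) (_ : MetricSpace X) (_ : CompactSpace X) (_ : Nonempty X) (T : X → X),
    IsMinimalSystem T ∧ ∃ (x : X) (U : Set X), IsOpen U ∧ U.Nonempty ∧ returnTimes T x U ⊆ A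

/-- `A` is dynamically central syndetic: it contains some `R(x, U)`, where `(X, T)` is a minimal
system, `U ⊆ X` is open and `x ∈ U`. -/
def IsDynamicallyCentralSyndetic (A : Set ℕ+) : Prop :=
  ∃ (X : Type) (_ : MetricSpace X) (_ : CompactSpace X) (_ : Nonempty X) (T : X → X),
    IsMinimalSystem T ∧ ∃ (x : X) (U : Set X), IsOpen U ∧ x ∈ U ∧ returnTimes T x U ⊆ A

/-- Piecewise syndetic sets. -/
def PS : Set (Set ℕ+) := {A | IsPiecewiseSyndetic A}

/-- Sets of pointwise recurrence. -/
def dcT : Set (Set ℕ+) := {A | IsPointwiseRecurrence A}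

/-- Dynamically thick sets. -/
def dT : Set (Set ℕ+) := {A | IsDynamicallyThick A}

/-- Dynamically syndetic sets. -/
def dS : Set (Set ℕ+) := {A | IsDynamicallySyndetic A}

/-- Dynamically central syndetic sets. -/
def dcS : Set (Set ℕ+) := {A | IsDynamicallyCentralSyndetic A}

/-- Dynamically central piecewise syndetic sets: the intersections `B ∩ C` of a dynamically
central syndetic set `B` and a set of pointwise recurrence `C`. -/
def dcPS : Set (Set ℕ+) := {A | ∃ B ∈ dcS, ∃ C ∈ dcT, A = B ∩ C}

/-- The dual of `𝓕`: the sets that meet every member of `𝓕`. -/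
def dual (𝓕 : Set (Set ℕ+)) : Set (Set ℕ+) := {B | ∀ A ∈ 𝓕, (B ∩ A).Nonempty}

/-- Removing `E` preserves membership in `𝓕`. -/
def RemovalPreserves (E : Set ℕ+) (𝓕 : Set (Set ℕ+)) : Prop := ∀ A ∈ 𝓕, A \ E ∈ 𝓕

end Recurrence

namespace Recurrence

/-! Everything rests on one fact: if `E` is not piecewise syndetic, then `R(x, U) \ E` is again
dynamically (central) syndetic. Put `B = {n ≥ 0 : T^n x ∈ U} \ E`. For finite `F ⊆ B`, `x` lies in
the open set `⋂_{f ∈ F} T^{-f} U`, so by minimality its visit times are syndetic, and they stay so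
after removal of the sets `E - f`. Hence `⋂_{f ∈ F} (B - f)` is syndetic
(`isSyndeticNat_translates_visits_diff`).

This property lets one build a uniformly recurrent 0-1 sequence supported on `B`
(`exists_uniformlyRecurrent`): a finite word supported on `B` can be copied inside `B` with bounded
gaps. The orbit closure of the sequence is the new minimal system.

The other families follow by duality, since `dT` and `dcT` are the duals of `dS` and `dcS`.
Conversely, if removing `E` preserves `dS`, so does removing any finite union of shifts of `E`; the
complement of such a union is then syndetic, so the union is not thick. -/

/-! ### Syndetic and piecewise syndetic subsets of `ℕ` -/

/-- `S` meets every interval of some fixed length. -/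
def IsSyndeticNat (S : Set ℕ) : Prop := ∃ N, ∀ m, ∃ n ∈ S, m ≤ n ∧ n < m + N

/-- On arbitrarily long intervals, `S` meets every window of some fixed length. -/
def IsPiecewiseSyndeticNat (S : Set ℕ) : Prop :=
  ∃ N, ∀ l, ∃ a, ∀ m, a ≤ m → m < a + l → ∃ n ∈ S, m ≤ n ∧ n < m + N

theorem IsSyndeticNat.mono {S S' : Set ℕ} (h : IsSyndeticNat S) (hS : S ⊆ S') :
    IsSyndeticNat S' := by
  obtain ⟨N, hN⟩ := h
  refine ⟨N, fun m => ?_⟩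
  obtain ⟨n, hn, h⟩ := hN m
  exact ⟨n, hS hn, h⟩

theorem IsPiecewiseSyndeticNat.mono {S S' : Set ℕ} (h : IsPiecewiseSyndeticNat S) (hS : S ⊆ S') :
    IsPiecewiseSyndeticNat S' := by
  obtain ⟨N, hN⟩ := h
  refine ⟨N, fun l => ?_⟩
  obtain ⟨a, ha⟩ := hN l
  refine ⟨a, fun m h1 h2 => ?_⟩
  obtain ⟨n, hn, h⟩ := ha m h1 h2
  exact ⟨n, hS hn, h⟩

/-- Removing a set that is not piecewise syndetic preserves syndeticity. -/
theorem IsSyndeticNat.diff {S E : Set ℕ} (hS : IsSyndeticNat S)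
    (hE : ¬ IsPiecewiseSyndeticNat E) : IsSyndeticNat (S \ E) := by
  obtain ⟨N, hN⟩ := hS
  simp only [IsPiecewiseSyndeticNat] at hE
  push Not at hE
  -- Every interval of length `l` contains some `k` with `[k, k + N)` free of `E`; `S` meets that
  -- window.
  obtain ⟨l, hl⟩ := hE N
  refine ⟨l + N, fun m => ?_⟩
  obtain ⟨k, hk1, hk2, hk⟩ := hl m
  obtain ⟨n, hn, h1, h2⟩ := hN k
  exact ⟨n, ⟨hn, fun h => absurd (hk n h h1) (by omega)⟩, by omega, by omega⟩

/-- Removing a set that is not piecewise syndetic preserves piecewise syndeticity. -/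
theorem IsPiecewiseSyndeticNat.diff {S E : Set ℕ} (hS : IsPiecewiseSyndeticNat S)
    (hE : ¬ IsPiecewiseSyndeticNat E) : IsPiecewiseSyndeticNat (S \ E) := by
  obtain ⟨N, hN⟩ := hS
  simp only [IsPiecewiseSyndeticNat] at hE
  push Not at hE
  obtain ⟨l, hl⟩ := hE N
  refine ⟨l + N, fun L => ?_⟩
  -- The extra `l` keeps the `E`-free window found after `m` within the range where `S` has bounded
  -- gaps.
  obtain ⟨a, ha⟩ := hN (L + l)
  refine ⟨a, fun m h1 h2 => ?_⟩
  obtain ⟨k, hk1, hk2, hk⟩ := hl m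
  obtain ⟨n, hn, h3, h4⟩ := ha k (by omega) (by omega)
  exact ⟨n, ⟨hn, fun h => absurd (hk n h h3) (by omega)⟩, by omega, by omega⟩

theorem IsPiecewiseSyndeticNat.of_shift {E : Set ℕ} {f : ℕ}
    (h : IsPiecewiseSyndeticNat {n | n + f ∈ E}) : IsPiecewiseSyndeticNat E := by
  obtain ⟨N, hN⟩ := h
  refine ⟨N, fun l => ?_⟩
  obtain ⟨a, ha⟩ := hN l
  refine ⟨a + f, fun m h1 h2 => ?_⟩
  obtain ⟨n, hn, h3, h4⟩ := ha (m - f) (by omega) (by omega)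
  exact ⟨n + f, hn, by omega, by omega⟩

theorem IsSyndeticNat.diff_shifts {S E : Set ℕ} (hS : IsSyndeticNat S)
    (hE : ¬ IsPiecewiseSyndeticNat E) (F : Finset ℕ) :
    IsSyndeticNat {n ∈ S | ∀ f ∈ F, n + f ∉ E} := by
  induction F using Finset.induction_on with
  | empty => simpa using hS
  | insert f F hf ih =>
    refine (ih.diff (E := {n | n + f ∈ E}) fun h => hE h.of_shift).mono ?_
    rintro n ⟨⟨h1, h2⟩, h3⟩
    refine ⟨h1, fun g hg => ?_⟩
    rcases Finset.mem_insert.1 hg with rfl | hg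
    · exact h3
    · exact h2 g hg

/-! ### Recurrence of words under concatenation -/

/-- A finite word, with a bound on the distance between its occurrences. Only the values of
`word` below `len` matter. -/
structure Pattern where
  word : ℕ → Bool
  len : ℕ
  gap : ℕ

/-- The pattern `p` occurs in `u` at position `s`. -/
def OccursAt (p : Pattern) (u : ℕ → Bool) (s : ℕ) : Prop := ∀ i < p.len, u (s + i) = p.word i

/-- The pattern `p` recurs in the restriction of `u` to `[a, b)`: it occurs soon after `a`, and
soon after every other position. -/
def Recurs (p : Pattern) (u : ℕ → Bool) (a b : ℕ) : Prop :=
  (a + p.gap ≤ b → ∃ s, a ≤ s ∧ s < a + p.gap ∧ s + p.len ≤ b ∧ OccursAt p u s) ∧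
  ∀ m, a ≤ m → m + p.gap + p.len ≤ b →
    ∃ s, m ≤ s ∧ s < m + p.gap + p.len ∧ s + p.len ≤ b ∧ OccursAt p u s

/-- The word `w` of length `N` starts and ends with the pattern `p`, which recurs in it. -/
structure Framed (p : Pattern) (w : ℕ → Bool) (N : ℕ) : Prop where
  len_le : p.len ≤ N
  first : OccursAt p w 0
  last : OccursAt p w (N - p.len)
  recurs : Recurs p w 0 N

theorem recurs_of_lt {p : Pattern} {u : ℕ → Bool} {a b : ℕ} (h : b < a + p.gap) :
    Recurs p u a b :=
  ⟨fun h' => absurd h' (by omega), fun m h1 h2 => absurd h2 (by omega)⟩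

/-- The sequence that agrees with `u₁` before `d`, with a copy of `w` on `[d, e)`, and with `u₂`
from `e` on. -/
def concat (d e : ℕ) (u₁ w u₂ : ℕ → Bool) : ℕ → Bool :=
  fun n => if n < d then u₁ n else if n < e then w (n - d) else u₂ n

section concat

variable {d N : ℕ} {u₁ w u₂ : ℕ → Bool} {p : Pattern} {s : ℕ}

theorem OccursAt.concat_left (h : OccursAt p u₁ s) (hs : s + p.len ≤ d) :
    OccursAt p (concat d (d + N) u₁ w u₂) s := by
  intro i hi
  rw [← h i hi, concat, if_pos (by omega)]

theorem OccursAt.concat_mid (h : OccursAt p w s) (hs : s + p.len ≤ N) :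
    OccursAt p (concat d (d + N) u₁ w u₂) (d + s) := by
  intro i hi
  rw [← h i hi, concat, if_neg (by omega), if_pos (by omega)]
  congr 1
  omega

theorem OccursAt.concat_right (h : OccursAt p u₂ s) (hs : d + N ≤ s) :
    OccursAt p (concat d (d + N) u₁ w u₂) s := by
  intro i hi
  rw [← h i hi, concat, if_neg (by omega), if_neg (by omega)]

/-- Copies of `p` at both ends of `w` bridge the two seams. The one exception is a position too
close to the end of `w` for `p` to fit: there the first clause of `Recurs` for `u₂` gives a copy, at
the cost of the additional `p.len` in the second clause. -/
theorem Recurs.concat {a b : ℕ} (hab : d + N ≤ b)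
    (h₁ : Recurs p u₁ a d) (hw : Framed p w N) (h₂ : Recurs p u₂ (d + N) b) (had : a ≤ d) :
    Recurs p (concat d (d + N) u₁ w u₂) a b := by
  have hlen := hw.len_le
  have hd : OccursAt p (Recurrence.concat d (d + N) u₁ w u₂) d := by
    simpa using hw.first.concat_mid (d := d) (u₁ := u₁) (u₂ := u₂) (N := N) (by omega)
  constructor
  · intro h
    by_cases hL : a + p.gap ≤ d
    · obtain ⟨s, h1, h2, h3, h4⟩ := h₁.1 hL
      exact ⟨s, h1, h2, by omega, h4.concat_left h3⟩
    · exact ⟨d, had, by omega, by omega, hd⟩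
  · intro m hm hmb
    by_cases hmd : m ≤ d
    · by_cases hL : m + p.gap + p.len ≤ d
      · obtain ⟨s, h1, h2, h3, h4⟩ := h₁.2 m hm hL
        exact ⟨s, h1, h2, by omega, h4.concat_left h3⟩
      · by_cases hpos : 0 < p.gap + p.len
        · exact ⟨d, hmd, by omega, by omega, hd⟩
        · obtain ⟨s, h1, h2, -⟩ := hw.recurs.2 0 le_rfl (by omega)
          omega
    · by_cases hme : m < d + N
      · by_cases hL : m + p.gap + p.len ≤ d + N
        · obtain ⟨s, h1, h2, h3, h4⟩ := hw.recurs.2 (m - d) (by omega) (by omega)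
          exact ⟨d + s, by omega, by omega, by omega, h4.concat_mid h3⟩
        · by_cases hl : m + p.len ≤ d + N
          · exact ⟨d + (N - p.len), by omega, by omega, by omega, hw.last.concat_mid (by omega)⟩
          · obtain ⟨s, h1, h2, h3, h4⟩ := h₂.1 (by omega)
            exact ⟨s, by omega, by omega, by omega, h4.concat_right h1⟩
      · obtain ⟨s, h1, h2, h3, h4⟩ := h₂.2 m (by omega) hmb
        exact ⟨s, by omega, by omega, by omega, h4.concat_right (by omega)⟩

end concat

/-- Every interval carries a word, supported on `B`, in which all patterns of `C` recur. -/
def Fillable (B : Set ℕ) (C : Set Pattern) : Prop :=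
  ∀ a b, a ≤ b → ∃ u : ℕ → Bool,
    (∀ n, a ≤ n → n < b → u n = true → n ∈ B) ∧ ∀ p ∈ C, Recurs p u a b

theorem framed_self {w : ℕ → Bool} {N L : ℕ} (hL : 0 < L) : Framed ⟨w, N, L⟩ w N where
  len_le := le_rfl
  first := fun i _ => by simp
  last := fun i _ => by simp
  recurs := ⟨fun _ => ⟨0, le_rfl, by simpa using hL, by simp, fun i _ => by simp⟩,
    fun m _ h => absurd h (by simp only; omega)⟩

/-- Greedy tiling: fill up to the next admissible place `d` for `w` with an old word, put `w` there,
and repeat from `d + N`. The gap `H + N` guarantees that an interval at least that long has room for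
such a copy; shorter ones impose nothing for the new pattern. -/
theorem Fillable.insert {B : Set ℕ} {C : Set Pattern} (hC : Fillable B C) {w : ℕ → Bool} {N H : ℕ}
    (hN : 0 < N) (hw : ∀ p ∈ C, Framed p w N)
    (hH : ∀ m, ∃ d, (∀ i < N, w i = true → d + i ∈ B) ∧ m ≤ d ∧ d < m + H) :
    Fillable B (insert ⟨w, N, H + N⟩ C) := by
  have key : ∀ k a b, a ≤ b → b - a ≤ k → ∃ u : ℕ → Bool,
      (∀ n, a ≤ n → n < b → u n = true → n ∈ B) ∧
        ∀ p ∈ Insert.insert (⟨w, N, H + N⟩ : Pattern) C, Recurs p u a b := by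
    intro k
    induction k with
    | zero =>
      intro a b hab hk
      obtain ⟨u, hu, hp⟩ := hC a b hab
      refine ⟨u, hu, ?_⟩
      rintro p (rfl | h)
      · exact recurs_of_lt (by simp only; omega)
      · exact hp p h
    | succ k ih =>
      intro a b hab hk
      by_cases hlt : b < a + (H + N)
      · obtain ⟨u, hu, hp⟩ := hC a b hab
        refine ⟨u, hu, ?_⟩
        rintro p (rfl | h)
        · exact recurs_of_lt hlt
        · exact hp p h
      · obtain ⟨d, hd, h1, h2⟩ := hH a
        obtain ⟨u₁, hu₁, hp₁⟩ := hC a d h1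
        obtain ⟨u₂, hu₂, hp₂⟩ := ih (d + N) b (by omega) (by omega)
        refine ⟨concat d (d + N) u₁ w u₂, ?_, ?_⟩
        · intro n hn1 hn2 h
          simp only [concat] at h
          split_ifs at h with h3 h4
          · exact hu₁ n hn1 h3 h
          · have := hd (n - d) (by omega) h
            rwa [show d + (n - d) = n by omega] at this
          · exact hu₂ n (by omega) hn2 h
        · intro p hp
          have h₂ := hp₂ p hp
          rcases hp with rfl | hp
          · exact Recurs.concat (by omega) (recurs_of_lt (by simp only; omega))
              (framed_self (by omega)) h₂ h1
          · exact Recurs.concat (by omega) (hp₁ p hp) (hw p hp) h₂ h1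
  exact fun a b hab => key (b - a) a b hab le_rfl

/-! ### Construction of a uniformly recurrent sequence supported on `B` -/

/-- A step of the construction of a uniformly recurrent sequence supported on `B`: a nonempty word
supported on `B`, framed by all the patterns considered so far. -/
structure Stage (B : Set ℕ) where
  patterns : Set Pattern
  word : ℕ → Bool
  len : ℕ
  len_pos : 0 < len
  supp : ∀ i < len, word i = true → i ∈ B
  fill : Fillable B patterns
  framed : ∀ p ∈ patterns, Framed p word len

/-- The next word is `w u w`, where the second `w` starts at a place `d ≥ N` with its support inside
`B`, and `u` fills `[N, d)`. Beginning and ending with `w`, it is framed by all old patterns and by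
`w` itself. -/
theorem Stage.exists_next {B : Set ℕ}
    (hB : ∀ F : Finset ℕ, (∀ f ∈ F, f ∈ B) → IsSyndeticNat {n | ∀ f ∈ F, n + f ∈ B})
    (S : Stage B) : ∃ S' : Stage B, S.patterns ⊆ S'.patterns ∧
      (∃ L, (⟨S.word, S.len, L⟩ : Pattern) ∈ S'.patterns) ∧ S.len < S'.len ∧
      ∀ i < S.len, S'.word i = S.word i := by
  obtain ⟨C, w, N, hN, hs, hfill, hfr⟩ := S
  obtain ⟨H, hH⟩ := hB ((Finset.range N).filter fun i => w i = true) (by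
    intro f hf
    simp only [Finset.mem_filter, Finset.mem_range] at hf
    exact hs f hf.1 hf.2)
  have hH' : ∀ m, ∃ d, (∀ i < N, w i = true → d + i ∈ B) ∧ m ≤ d ∧ d < m + H := by
    intro m
    obtain ⟨d, hd, h⟩ := hH m
    exact ⟨d, fun i hi hwi => hd i (by simp [hi, hwi]), h⟩
  have hfill' := hfill.insert hN hfr hH'
  have hfr' : ∀ p ∈ insert (⟨w, N, H + N⟩ : Pattern) C, Framed p w N := by
    rintro p (rfl | hp)
    · exact framed_self (by omega)
    · exact hfr p hp
  obtain ⟨d, hd, hNd, -⟩ := hH' N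
  obtain ⟨u, hu, hrec⟩ := hfill' N d hNd
  set v := concat d (d + N) u w w with hv
  set W := concat 0 (0 + N) w w v with hW
  have hWN : ∀ i < N, W i = w i := fun i hi => by simp [hW, concat, hi]
  have hgap : ∀ p ∈ insert (⟨w, N, H + N⟩ : Pattern) C, 0 < p.gap + p.len := by
    intro p hp
    by_contra hcon
    obtain ⟨s, h1, h2, -⟩ := (hfr' p hp).recurs.2 0 le_rfl (by omega)
    omega
  refine ⟨⟨_, W, d + N, by omega, ?_, hfill', ?_⟩, Set.subset_insert _ _,
    ⟨H + N, Set.mem_insert _ _⟩, by simp only; omega, hWN⟩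
  · intro i hi h
    simp only [hW, hv, concat] at h
    split_ifs at h with h1 h2 h3
    · omega
    · exact hs i (by omega) (by simpa using h)
    · exact hu i (by omega) h3 h
    · have := hd (i - d) (by omega) h
      rwa [show d + (i - d) = i by omega] at this
  · intro p hp
    have hf := hfr' p hp
    have hlen := hf.len_le
    refine ⟨by omega, ?_, ?_, ?_⟩
    · intro i hi
      rw [← hf.first i hi]
      simpa using hWN i (by omega)
    · have h1 : OccursAt p v (d + (N - p.len)) := hf.last.concat_mid (by omega)
      have h2 : OccursAt p W (d + (N - p.len)) := h1.concat_right (by omega)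
      rwa [show d + (N - p.len) = d + N - p.len by omega] at h2
    · have hempty : ∀ (u : ℕ → Bool) a, Recurs p u a a := by
        intro u a
        by_cases hg : 0 < p.gap
        · exact recurs_of_lt (by omega)
        · obtain ⟨s, h1, h2, -⟩ := hf.recurs.1 (by omega)
          omega
      have h1 : Recurs p v N (d + N) := Recurs.concat le_rfl (hrec p hp) hf (hempty _ _) hNd
      have h2 : Recurs p W 0 (d + N) :=
        Recurs.concat (by omega) (hempty _ _) hf (by simpa using h1) le_rfl
      exact h2

/-- If all sets `⋂_{f ∈ F} (B - f)` with `F ⊆ B` finite are syndetic, then `B` supports a uniformly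
recurrent sequence with any prescribed prefix that is supported on `B`. -/
theorem exists_uniformlyRecurrent {B : Set ℕ}
    (hB : ∀ F : Finset ℕ, (∀ f ∈ F, f ∈ B) → IsSyndeticNat {n | ∀ f ∈ F, n + f ∈ B})
    (w : ℕ → Bool) (N : ℕ) (hw : ∀ i < N, w i = true → i ∈ B) :
    ∃ y : ℕ → Bool, (∀ n, y n = true → n ∈ B) ∧ (∀ n < N, y n = w n) ∧
      ∀ k, ∃ G, ∀ m, ∃ s, m ≤ s ∧ s < m + G ∧ ∀ i < k, y (s + i) = y i := by
  choose next hsub hmem hlen hword using Stage.exists_next hB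
  let S₀ : Stage B :=
    { patterns := ∅
      word := fun n => if n < N then w n else false
      -- One extra zero makes the word nonempty even when `N = 0`.
      len := N + 1
      len_pos := by omega
      supp := by
        intro i _ h
        split_ifs at h with h1
        exact hw i h1 h
      fill := fun a b _ => ⟨fun _ => false, by simp, by simp⟩
      framed := by simp }
  let S : ℕ → Stage B := fun k => next^[k] S₀
  have hS : ∀ k, S (k + 1) = next (S k) := fun k => Function.iterate_succ_apply' _ _ _
  have hlen' : ∀ k, N + k < (S k).len := by
    intro k
    induction k with
    | zero => simp [S, S₀]
    | succ k ih => have := hlen (S k); rw [hS]; omega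
  have hmono : ∀ k j, (S k).len ≤ (S (k + j)).len ∧ (S k).patterns ⊆ (S (k + j)).patterns ∧
      ∀ i < (S k).len, (S (k + j)).word i = (S k).word i := by
    intro k j
    induction j with
    | zero => simp
    | succ j ih =>
      rw [← add_assoc, hS]
      have h := hlen (S (k + j))
      refine ⟨by omega, ih.2.1.trans (hsub _), fun i hi => ?_⟩
      rw [hword _ _ (by omega), ih.2.2 i hi]
  let y : ℕ → Bool := fun n => (S n).word n
  have hy : ∀ k, ∀ i < (S k).len, y i = (S k).word i := by
    intro k i hi
    have h1 := (hmono i k).2.2 i (by have := hlen' i; omega)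
    have h2 := (hmono k i).2.2 i hi
    rw [add_comm] at h2
    exact h1.symm.trans h2
  refine ⟨y, ?_, ?_, ?_⟩
  · intro n hn
    exact (S n).supp n (by have := hlen' n; omega) hn
  · intro n hn
    rw [hy 0 n (by have := hlen' 0; omega)]
    simp [S, S₀, hn]
  · intro k
    obtain ⟨L, hL⟩ := hmem (S k)
    rw [← hS] at hL
    refine ⟨L + (S k).len, fun m => ?_⟩
    -- A stage so late that its word reaches beyond the search window after `m`; the prefix of `y`
    -- is a pattern there, with a gap independent of `m`.
    have hfr := (S (k + 1 + (m + L + (S k).len))).framed _ ((hmono (k + 1) _).2.1 hL)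
    have hbig := hlen' (k + 1 + (m + L + (S k).len))
    obtain ⟨s, h1, h2, h3, h4⟩ := hfr.recurs.2 m (Nat.zero_le _) (by simp only; omega)
    simp only at h1 h2 h3
    refine ⟨s, h1, by omega, fun i hi => ?_⟩
    have hik : i < (S k).len := by have := hlen' k; omega
    rw [hy k i hik, hy (k + 1 + (m + L + (S k).len)) (s + i) (by omega)]
    exact h4 i hik

/-! ### Minimal systems and orbit closures -/

/-- The set of all times `n ≥ 0` at which `x` visits `U`. -/
def visits {X : Type} (T : X → X) (x : X) (U : Set X) : Set ℕ := {n | T^[n] x ∈ U}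

/-- The points that never enter `U` form a closed invariant set, empty by minimality; compactness
then bounds the entrance time uniformly. -/
theorem IsMinimalSystem.isSyndeticNat_visits {X : Type} [TopologicalSpace X] [CompactSpace X]
    {T : X → X} (hT : IsMinimalSystem T) (x : X) {U : Set X} (hU : IsOpen U) (hne : U.Nonempty) :
    IsSyndeticNat (visits T x U) := by
  have hcover : ∀ z, ∃ n, T^[n] z ∈ U := by
    by_contra! h
    obtain ⟨z, hz⟩ := h
    have huniv := hT.2 {z | ∀ n, T^[n] z ∉ U} ⟨z, hz⟩ (by
      simp only [Set.ofPred_forall]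
      exact isClosed_iInter fun n => (hU.preimage (hT.1.iterate n)).isClosed_compl) (by
      rintro _ ⟨z, hz, rfl⟩ n
      exact hz (n + 1))
    obtain ⟨u, hu⟩ := hne
    have : u ∈ {z | ∀ n, T^[n] z ∉ U} := huniv ▸ Set.mem_univ u
    exact this 0 hu
  obtain ⟨t, ht⟩ := isCompact_univ.elim_finite_subcover (fun n => T^[n] ⁻¹' U)
    (fun n => hU.preimage (hT.1.iterate n)) fun z _ => Set.mem_iUnion.2 (hcover z)
  refine ⟨t.sup id + 1, fun m => ?_⟩
  obtain ⟨n, hn, hmem⟩ := Set.mem_iUnion₂.1 (ht (Set.mem_univ (T^[m] x)))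
  have hle : n ≤ t.sup id := Finset.le_sup (f := id) hn
  refine ⟨n + m, ?_, by omega, by omega⟩
  rw [visits, Set.mem_ofPred_eq, Function.iterate_add_apply]
  exact hmem

theorem IsMinimalSystem.surjective {X : Type} [TopologicalSpace X] [CompactSpace X] [T2Space X]
    [Nonempty X] {T : X → X} (hT : IsMinimalSystem T) : Function.Surjective T := by
  rw [← Set.range_eq_univ]
  refine hT.2 _ (Set.range_nonempty T) (isCompact_range hT.1).isClosed ?_
  rintro _ ⟨z, -, rfl⟩
  exact Set.mem_range_self z

/-- The shift on sequences of bits. -/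
def seqShift (z : ℕ → Bool) : ℕ → Bool := fun n => z (n + 1)

theorem seqShift_iterate (m : ℕ) (z : ℕ → Bool) : seqShift^[m] z = fun n => z (n + m) := by
  induction m with
  | zero => rfl
  | succ m ih =>
    rw [Function.iterate_succ_apply', ih]
    funext n
    simp only [seqShift]
    congr 1
    omega

theorem continuous_seqShift : Continuous seqShift :=
  continuous_pi fun n => continuous_apply (n + 1)

theorem mem_closure_seq_iff {Y : Set (ℕ → Bool)} {z : ℕ → Bool} :
    z ∈ closure Y ↔ ∀ k, ∃ y ∈ Y, ∀ i < k, y i = z i := by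
  constructor
  · intro h k
    have hopen : IsOpen {y : ℕ → Bool | ∀ i < k, y i = z i} := by
      have : {y : ℕ → Bool | ∀ i < k, y i = z i} = ⋂ i ∈ Set.Iio k, {y | y i = z i} := by
        ext; simp
      rw [this]
      refine (Set.finite_Iio k).isOpen_biInter fun i _ => ?_
      exact (isOpen_discrete ({z i} : Set Bool)).preimage
        (continuous_apply (A := fun _ : ℕ => Bool) i)
    obtain ⟨y, hy, hyY⟩ := mem_closure_iff.1 h _ hopen fun _ _ => rfl
    exact ⟨y, hyY, hy⟩
  · intro h
    choose y hy hyz using h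
    refine mem_closure_of_tendsto (b := Filter.atTop) (f := y) ?_ (Filter.Eventually.of_forall hy)
    rw [tendsto_pi_nhds]
    intro i
    refine tendsto_const_nhds.congr' ?_
    filter_upwards [Filter.eventually_gt_atTop i] with k hk
    exact (hyz k i hk).symm

/-- The orbit closure of a uniformly recurrent sequence of bits is a minimal system. -/
theorem exists_minimal_of_uniformlyRecurrent {y : ℕ → Bool}
    (hy : ∀ k, ∃ G, ∀ m, ∃ s, m ≤ s ∧ s < m + G ∧ ∀ i < k, y (s + i) = y i) :
    ∃ (X : Type) (_ : MetricSpace X) (_ : CompactSpace X) (_ : Nonempty X) (T : X → X),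
      IsMinimalSystem T ∧ ∃ (x : X) (U : Set X), IsOpen U ∧
        ∀ n, T^[n] x ∈ U ↔ y n = true := by
  set O : Set (ℕ → Bool) := Set.range fun m => seqShift^[m] y with hO
  have hmaps : Set.MapsTo seqShift (closure O) (closure O) := by
    refine Set.MapsTo.closure ?_ continuous_seqShift
    rintro _ ⟨m, rfl⟩
    exact ⟨m + 1, Function.iterate_succ_apply' _ _ _⟩
  have hyO : y ∈ closure O := subset_closure ⟨0, rfl⟩
  let T : closure O → closure O := hmaps.restrict
  have hTit : ∀ n (z : closure O), ((T^[n] z : closure O) : ℕ → Bool) = seqShift^[n] z := by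
    intro n
    induction n with
    | zero => intro z; rfl
    | succ n ih => intro z; rw [Function.iterate_succ_apply, ih]; rfl
  have hTc : Continuous T := (continuous_seqShift.comp continuous_subtype_val).subtype_mk _
  refine ⟨closure O, TopologicalSpace.metrizableSpaceMetric _,
    isCompact_iff_compactSpace.1 isClosed_closure.isCompact, ⟨⟨y, hyO⟩⟩, T, ⟨hTc, ?_⟩,
    ⟨y, hyO⟩, {z | (z : ℕ → Bool) 0 = true}, ?_, ?_⟩
  · intro Y hYne hYc hYT
    have hit : ∀ n, ∀ z ∈ Y, T^[n] z ∈ Y := by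
      intro n
      induction n with
      | zero => exact fun z hz => hz
      | succ n ih => exact fun z hz => ih _ (hYT ⟨z, hz, rfl⟩)
    have hYc' : IsClosed (Subtype.val '' Y) := 
      isClosed_closure.isClosedEmbedding_subtypeVal.isClosedMap _ hYc
    have hyY : y ∈ Subtype.val '' Y := by
      rw [← hYc'.closure_eq, mem_closure_seq_iff]
      intro k
      obtain ⟨G, hG⟩ := hy k
      obtain ⟨z, hz⟩ := hYne
      -- `z` agrees with a shift of `y` on `G + k` entries, enough to contain a copy of the
      -- `k`-prefix of `y`.
      obtain ⟨_, ⟨m, rfl⟩, hm⟩ := mem_closure_seq_iff.1 z.2 (G + k)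
      obtain ⟨s, h1, h2, h3⟩ := hG m
      refine ⟨_, ⟨T^[s - m] z, hit _ z hz, rfl⟩, fun i hi => ?_⟩
      rw [hTit, seqShift_iterate, ← h3 i hi]
      refine (hm (i + (s - m)) (by omega)).symm.trans ?_
      simp only [seqShift_iterate]
      congr 1
      omega
    obtain ⟨y', hy', hyy'⟩ := hyY
    have hOY : O ⊆ Subtype.val '' Y := by
      rintro _ ⟨m, rfl⟩
      exact ⟨T^[m] y', hit m y' hy', by rw [hTit, hyy']⟩
    refine Set.eq_univ_of_forall fun z => ?_
    obtain ⟨z', hz', h⟩ := closure_minimal hOY hYc' z.2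
    rwa [← Subtype.ext h]
  · exact (isOpen_discrete ({true} : Set Bool)).preimage
      ((continuous_apply (A := fun _ : ℕ => Bool) 0).comp continuous_subtype_val)
  · intro n
    rw [Set.mem_ofPred_eq, hTit, seqShift_iterate]
    simp

/-! ### Removing a set that is not piecewise syndetic -/

/-- The positive times in `B` form a dynamically (central) syndetic set as soon as the sets
`⋂_{f ∈ F} (B - f)` with `F ⊆ B` finite are syndetic. -/
theorem exists_minimal_visits_subset {B : Set ℕ}
    (hB : ∀ F : Finset ℕ, (∀ f ∈ F, f ∈ B) → IsSyndeticNat {n | ∀ f ∈ F, n + f ∈ B})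
    {b : ℕ} (hb : b ∈ B) :
    ∃ (X : Type) (_ : MetricSpace X) (_ : CompactSpace X) (_ : Nonempty X) (T : X → X),
      IsMinimalSystem T ∧ ∃ (x : X) (U : Set X), IsOpen U ∧ T^[b] x ∈ U ∧ visits T x U ⊆ B := by
  obtain ⟨y, hyB, hyw, hyr⟩ := exists_uniformlyRecurrent hB (fun n => n == b) (b + 1)
    (fun i _ h => by rwa [beq_iff_eq.1 h])
  obtain ⟨X, i1, i2, i3, T, hT, x, U, hU, hxU⟩ := exists_minimal_of_uniformlyRecurrent hyr
  exact ⟨X, i1, i2, i3, T, hT, x, U, hU, (hxU b).2 (by rw [hyw b (by omega)]; simp),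
    fun n hn => hyB n ((hxU n).1 hn)⟩

theorem isSyndeticNat_translates_visits_diff {X : Type} [TopologicalSpace X] [CompactSpace X]
    {T : X → X} (hT : IsMinimalSystem T) (x : X) {U : Set X} (hU : IsOpen U)
    {E : Set ℕ} (hE : ¬ IsPiecewiseSyndeticNat E) (F : Finset ℕ)
    (hF : ∀ f ∈ F, f ∈ visits T x U \ E) :
    IsSyndeticNat {n | ∀ f ∈ F, n + f ∈ visits T x U \ E} := by
  have hV : IsOpen (⋂ f ∈ F, T^[f] ⁻¹' U) :=
    isOpen_biInter_finset fun f _ => hU.preimage (hT.1.iterate f)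
  refine ((hT.isSyndeticNat_visits x hV ⟨x, ?_⟩).diff_shifts hE F).mono ?_
  · exact Set.mem_iInter₂.2 fun f hf => (hF f hf).1
  · rintro n ⟨hn, h⟩ f hf
    refine ⟨?_, h f hf⟩
    have := Set.mem_iInter₂.1 hn f hf
    rwa [Set.mem_preimage, ← Function.iterate_add_apply, add_comm] at this

/-- Membership of `m` in the union up to `N` means that `E` meets `[m, m + N]`, a window of length
`N + 1`. -/
theorem isPiecewiseSyndetic_iff (E : Set ℕ+) :
    IsPiecewiseSyndetic E ↔ IsPiecewiseSyndeticNat ((↑) '' E : Set ℕ) := by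
  have hmem : ∀ (N m : ℕ+), m ∈ E ∪ ⋃ n ∈ Set.Icc 1 N, shift E n ↔
      ∃ n ∈ ((↑) '' E : Set ℕ), (m : ℕ) ≤ n ∧ n < m + (N + 1) := by
    intro N m
    simp only [Set.mem_union, Set.mem_iUnion, shift, Set.mem_ofPred_eq, Set.exists_mem_image,
      Set.mem_Icc, exists_prop]
    constructor
    · rintro (h | ⟨n, ⟨-, hn⟩, h⟩)
      · exact ⟨m, h, le_rfl, by omega⟩
      · have : (n : ℕ) ≤ N := hn
        exact ⟨m + n, h, by simp, by simp only [PNat.add_coe]; omega⟩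
    · rintro ⟨n, hn, h1, h2⟩
      rcases h1.eq_or_lt with h | h
      · exact Or.inl (PNat.coe_injective h ▸ hn)
      · have hlt : m < n := h
        have hadd : m + (n - m) = n := PNat.add_sub_of_lt hlt
        have hcoe : (m : ℕ) + ((n - m : ℕ+) : ℕ) = n := by rw [← PNat.add_coe, hadd]
        refine Or.inr ⟨n - m, ⟨one_le, ?_⟩, by rwa [hadd]⟩
        rw [← PNat.coe_le_coe]
        omega
  constructor
  · rintro ⟨N, hN⟩
    refine ⟨N + 1, fun l => ?_⟩
    obtain ⟨a, ha⟩ := hN (Finset.Icc 1 l.succPNat)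
    refine ⟨a + 1, fun m h1 h2 => ?_⟩
    obtain ⟨k, hk⟩ : ∃ k : ℕ+, (k : ℕ) = m - a := ⟨⟨m - a, by omega⟩, rfl⟩
    have hm := ha k (by
      rw [Finset.mem_Icc, ← PNat.coe_le_coe, ← PNat.coe_le_coe]
      simp
      omega)
    rwa [hmem, PNat.add_coe, show (k : ℕ) + a = m by omega] at hm
  · rintro ⟨N, hN⟩
    refine ⟨N.succPNat, fun F => ?_⟩
    obtain ⟨l, hl⟩ : ∃ l : ℕ, ∀ f ∈ F, (f : ℕ) ≤ l :=
      ⟨F.sup (↑), fun f hf => Finset.le_sup (f := ((↑) : ℕ+ → ℕ)) hf⟩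
    obtain ⟨a, ha⟩ := hN (l + 2)
    refine ⟨a.succPNat, fun f hf => ?_⟩
    rw [hmem]
    obtain ⟨n, hn, h1, h2⟩ := ha ((f + a.succPNat : ℕ+) : ℕ) (by simp; omega) (by
      have := hl f hf
      simp
      omega)
    exact ⟨n, hn, h1, by simp at h2 ⊢; omega⟩

theorem coe_mem_image_iff {E : Set ℕ+} {n : ℕ+} : (n : ℕ) ∈ ((↑) '' E : Set ℕ) ↔ n ∈ E :=
  PNat.coe_injective.mem_set_image

theorem removalPreserves_dcS {E : Set ℕ+} (hE : E ∉ PS) : RemovalPreserves E dcS := by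
  rintro A ⟨X, i1, i2, i3, T, hT, x, U, hU, hxU, hA⟩
  have hE' : ¬ IsPiecewiseSyndeticNat ((↑) '' E : Set ℕ) :=
    fun h => hE ((isPiecewiseSyndetic_iff E).2 h)
  -- Time `0` encodes `x ∈ U`, and `E` contains only positive times; prescribing a one at `0` yields
  -- `x' ∈ U'`.
  have h0 : 0 ∈ visits T x U \ ((↑) '' E : Set ℕ) := by
    refine ⟨hxU, ?_⟩
    rintro ⟨e, -, he⟩
    exact e.ne_zero he
  obtain ⟨X', j1, j2, j3, T', hT', x', U', hU', hxU', hsub⟩ := exists_minimal_visits_subset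
    (isSyndeticNat_translates_visits_diff hT x hU hE') h0
  refine ⟨X', j1, j2, j3, T', hT', x', U', hU', hxU', fun n hn => ?_⟩
  obtain ⟨h1, h2⟩ := hsub hn
  exact ⟨hA h1, fun h => h2 (coe_mem_image_iff.2 h)⟩

theorem removalPreserves_dS {E : Set ℕ+} (hE : E ∉ PS) : RemovalPreserves E dS := by
  rintro A ⟨X, i1, i2, i3, T, hT, x, U, hU, hne, hA⟩
  have hE' : ¬ IsPiecewiseSyndeticNat ((↑) '' E : Set ℕ) :=
    fun h => hE ((isPiecewiseSyndetic_iff E).2 h)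
  obtain ⟨N, hN⟩ := (hT.isSyndeticNat_visits x hU hne).diff hE'
  -- Any element of the syndetic difference can serve as the prescribed one, making the new open set
  -- nonempty.
  obtain ⟨b, hb, -⟩ := hN 0
  obtain ⟨X', j1, j2, j3, T', hT', x', U', hU', hxU', hsub⟩ := exists_minimal_visits_subset
    (isSyndeticNat_translates_visits_diff hT x hU hE') hb
  refine ⟨X', j1, j2, j3, T', hT', x', U', hU', ⟨_, hxU'⟩, fun n hn => ?_⟩
  obtain ⟨h1, h2⟩ := hsub hn
  exact ⟨hA h1, fun h => h2 (coe_mem_image_iff.2 h)⟩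

/-! ### Duality and upward closure -/

theorem RemovalPreserves.dual {E : Set ℕ+} {F : Set (Set ℕ+)} (h : RemovalPreserves E F) :
    RemovalPreserves E (dual F) := by
  intro B hB A hA
  obtain ⟨n, hn, h1, h2⟩ := hB _ (h A hA)
  exact ⟨n, ⟨hn, h2⟩, h1⟩

/-- If `B ∉ F`, upward closure forces `Bᶜ` to meet every member of `F`, so `Bᶜ` is a member of the
dual that `B` misses. -/
theorem dual_dual {F : Set (Set ℕ+)} (hF : IsUpperSet F) : dual (dual F) = F := by
  ext B
  constructor
  · intro hB
    by_contra hBF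
    obtain ⟨n, hn, hn'⟩ := hB Bᶜ fun A hA => by
      by_contra hne
      refine hBF (hF (fun a ha => ?_) hA)
      by_contra haB
      exact hne ⟨a, haB, ha⟩
    exact hn' hn
  · intro hB A hA
    rw [Set.inter_comm]
    exact hA B hB

theorem isUpperSet_dS : IsUpperSet dS := by
  rintro A B hAB ⟨X, i1, i2, i3, T, hT, x, U, hU, hne, hA⟩
  exact ⟨X, i1, i2, i3, T, hT, x, U, hU, hne, hA.trans hAB⟩

theorem isUpperSet_dcS : IsUpperSet dcS := by
  rintro A B hAB ⟨X, i1, i2, i3, T, hT, x, U, hU, hxU, hA⟩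
  exact ⟨X, i1, i2, i3, T, hT, x, U, hU, hxU, hA.trans hAB⟩

theorem isUpperSet_dual (F : Set (Set ℕ+)) : IsUpperSet (dual F) :=
  fun _ _ hAB hA C hC => (hA C hC).mono (Set.inter_subset_inter_left C hAB)

theorem dT_eq_dual : dT = dual dS := by
  ext A
  constructor
  · rintro hA B ⟨X, i1, i2, i3, T, hT, x, U, hU, hne, hB⟩
    obtain ⟨n, hn, hnU⟩ := hA X T hT x U hU hne
    exact ⟨n, hn, hB hnU⟩
  · intro hA X i1 i2 i3 T hT x U hU hne
    exact hA (returnTimes T x U) ⟨X, i1, i2, i3, T, hT, x, U, hU, hne, subset_rfl⟩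

theorem dcT_eq_dual : dcT = dual dcS := by
  ext A
  constructor
  · rintro hA B ⟨X, i1, i2, i3, T, hT, x, U, hU, hne, hB⟩
    obtain ⟨n, hn, hnU⟩ := hA X T hT x U hU hne
    exact ⟨n, hn, hB hnU⟩
  · intro hA X i1 i2 i3 T hT x U hU hne
    exact hA (returnTimes T x U) ⟨X, i1, i2, i3, T, hT, x, U, hU, hne, subset_rfl⟩

theorem mem_iff_mem_of_symmDiff {F : Set (Set ℕ+)} (hF : IsUpperSet F)
    {A B : Set ℕ+} (h : RemovalPreserves (symmDiff A B) F) : A ∈ F ↔ B ∈ F := by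
  constructor
  · refine fun hA => hF ?_ (h A hA)
    rintro n ⟨hn, hnE⟩
    by_contra hB
    exact hnE (Or.inl ⟨hn, hB⟩)
  · refine fun hB => hF ?_ (h B hB)
    rintro n ⟨hn, hnE⟩
    by_contra hA
    exact hnE (Or.inr ⟨hn, hA⟩)

theorem removalPreserves_PS {E : Set ℕ+} (hE : E ∉ PS) : RemovalPreserves E PS := by
  intro A hA
  have hE' : ¬ IsPiecewiseSyndeticNat ((↑) '' E : Set ℕ) :=
    fun h => hE ((isPiecewiseSyndetic_iff E).2 h)
  refine (isPiecewiseSyndetic_iff _).2 ((((isPiecewiseSyndetic_iff A).1 hA).diff hE').mono ?_)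
  rintro _ ⟨⟨n, hn, rfl⟩, h⟩
  exact ⟨n, ⟨hn, fun hnE => h ⟨n, hnE, rfl⟩⟩, rfl⟩

theorem empty_notMem_PS : ∅ ∉ PS := by
  intro h
  obtain ⟨N, hN⟩ := (isPiecewiseSyndetic_iff ∅).1 h
  obtain ⟨a, ha⟩ := hN 1
  obtain ⟨n, hn, -⟩ := ha a le_rfl (by omega)
  simp at hn

theorem Iic_notMem_PS (k : ℕ+) : Set.Iic k ∉ PS := by
  intro h
  obtain ⟨N, hN⟩ := (isPiecewiseSyndetic_iff _).1 h
  obtain ⟨a, ha⟩ := hN (k + 2)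
  obtain ⟨_, ⟨n, hn, rfl⟩, h1, -⟩ := ha (a + k + 1) (by omega) (by omega)
  have : (n : ℕ) ≤ k := hn
  omega

/-! ### The converse for dynamically syndetic sets -/

theorem univ_mem_dS : Set.univ ∈ dS :=
  ⟨Unit, inferInstance, inferInstance, inferInstance, id,
    ⟨continuous_id, fun _ hY _ _ => hY.eq_univ⟩, (), Set.univ, isOpen_univ, Set.univ_nonempty,
    Set.subset_univ _⟩

theorem shift_mem_dS {A : Set ℕ+} (hA : A ∈ dS) (k : ℕ+) : shift A k ∈ dS := by
  obtain ⟨X, i1, i2, i3, T, hT, x, U, hU, hne, hA⟩ := hA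
  refine ⟨X, i1, i2, i3, T, hT, T^[k] x, U, hU, hne, fun n hn => ?_⟩
  refine hA ?_
  change T^[((n + k : ℕ+) : ℕ)] x ∈ U
  rw [PNat.add_coe, Function.iterate_add_apply]
  exact hn

/-- By surjectivity `x = T^k y`, so `R(y, U)` beyond time `k` lies in `A + k`; discarding the times
up to `k` is harmless because a finite set is not piecewise syndetic. -/
theorem translate_mem_dS {A : Set ℕ+} (hA : A ∈ dS) (k : ℕ+) : (· + k) '' A ∈ dS := by
  obtain ⟨X, i1, i2, i3, T, hT, x, U, hU, hne, hA⟩ := hA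
  obtain ⟨y, rfl⟩ := (hT.surjective.iterate k) x
  refine isUpperSet_dS ?_ (removalPreserves_dS (Iic_notMem_PS k) (returnTimes T y U)
    ⟨X, i1, i2, i3, T, hT, y, U, hU, hne, subset_rfl⟩)
  rintro n ⟨hn, hnk⟩
  have hlt : k < n := not_le.1 hnk
  have hadd : n - k + k = n := PNat.sub_add_of_lt hlt
  refine ⟨n - k, hA ?_, hadd⟩
  change T^[((n - k : ℕ+) : ℕ)] (T^[k] y) ∈ U
  rw [← Function.iterate_add_apply, ← PNat.add_coe, hadd]
  exact hn

/-- Move `A` by `k`, remove `E`, and move back. -/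
theorem RemovalPreserves.shift_dS {E : Set ℕ+} (h : RemovalPreserves E dS) (k : ℕ+) :
    RemovalPreserves (shift E k) dS := by
  intro A hA
  refine isUpperSet_dS ?_ (shift_mem_dS (h _ (translate_mem_dS hA k)) k)
  rintro n ⟨⟨m, hm, hmn⟩, hnE⟩
  obtain rfl : m = n := add_right_cancel hmn
  exact ⟨hm, hnE⟩

theorem notMem_PS_of_removalPreserves_dS {E : Set ℕ+} (h : RemovalPreserves E dS) : E ∉ PS := by
  rintro ⟨N, hN⟩
  have hfin : ∀ F : Finset ℕ+, RemovalPreserves (⋃ n ∈ F, shift E n) dS := by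
    intro F
    induction F using Finset.induction_on with
    | empty => intro A hA; simpa using hA
    | insert k F _ ih =>
      intro A hA
      rw [Finset.set_biUnion_insert, ← Set.sdiff_sdiff]
      exact ih _ (h.shift_dS k A hA)
  -- The complement of `E ∪ (E - 1) ∪ ⋯ ∪ (E - N)` contains return times with bounded gaps, whereas
  -- thickness puts arbitrarily long intervals in the union.
  have hmem : (Set.univ \ E) \ ⋃ n ∈ Finset.Icc 1 N, shift E n ∈ dS :=
    hfin _ _ (h _ univ_mem_dS)
  obtain ⟨X, i1, i2, i3, T, hT, x, U, hU, hne, hA⟩ := hmem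
  obtain ⟨M, hM⟩ := hT.isSyndeticNat_visits x hU hne
  obtain ⟨a, ha⟩ := hN (Finset.Iic M.succPNat)
  obtain ⟨n, hn, h1, h2⟩ := hM (a + 1)
  obtain ⟨f, hf⟩ : ∃ f : ℕ+, (f : ℕ) = n - a := ⟨⟨n - a, by omega⟩, rfl⟩
  have hfa : ((f + a : ℕ+) : ℕ) = n := by rw [PNat.add_coe]; omega
  have hret : f + a ∈ returnTimes T x U := by
    change T^[((f + a : ℕ+) : ℕ)] x ∈ U
    rw [hfa]
    exact hn
  obtain ⟨⟨-, hE⟩, hE'⟩ := hA hret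
  rcases ha f (by rw [Finset.mem_Iic, ← PNat.coe_le_coe]; simp; omega) with h | h
  · exact hE h
  · exact hE' (by simpa using h)

theorem notMem_PS_iff_removalPreserves_dS (E : Set ℕ+) : E ∉ PS ↔ RemovalPreserves E dS :=
  ⟨removalPreserves_dS, notMem_PS_of_removalPreserves_dS⟩

theorem removalPreserves_dcPS {E : Set ℕ+} (h : RemovalPreserves E dcS) :
    RemovalPreserves E dcPS := by
  rintro _ ⟨B, hB, C, hC, rfl⟩
  exact ⟨B \ E, h B hB, C, hC, by ext; simp; tauto⟩

end Recurrence

open Recurrence in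
theorem theoremG :
    (∀ A B : Set ℕ+, symmDiff A B ∉ PS →
      (A ∈ dcT ↔ B ∈ dcT) ∧ (A ∈ dT ↔ B ∈ dT) ∧ (A ∈ dS ↔ B ∈ dS) ∧ (A ∈ dcS ↔ B ∈ dcS)) ∧
    (∀ E : Set ℕ+,
      (E ∉ PS ↔ RemovalPreserves E dS) ∧
      (E ∉ PS ↔ RemovalPreserves E dT) ∧
      (E ∉ PS ↔ RemovalPreserves E PS) ∧
      (E ∉ PS ↔ RemovalPreserves E (dual PS)) ∧
      (E ∉ PS →
        RemovalPreserves E dcS ∧ RemovalPreserves E dcT ∧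
        RemovalPreserves E dcPS ∧ RemovalPreserves E (dual dcPS))) := by
  rw [dcT_eq_dual, dT_eq_dual]
  refine ⟨fun A B h => ?_, fun E => ⟨notMem_PS_iff_removalPreserves_dS E, ?_, ?_, ?_, ?_⟩⟩
  · have hS := removalPreserves_dS h
    have hcS := removalPreserves_dcS h
    exact ⟨mem_iff_mem_of_symmDiff (isUpperSet_dual _) hcS.dual,
      mem_iff_mem_of_symmDiff (isUpperSet_dual _) hS.dual,
      mem_iff_mem_of_symmDiff isUpperSet_dS hS, mem_iff_mem_of_symmDiff isUpperSet_dcS hcS⟩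
  · rw [notMem_PS_iff_removalPreserves_dS]
    refine ⟨fun h => h.dual, fun h => ?_⟩
    simpa only [dual_dual isUpperSet_dS] using h.dual
  · refine ⟨removalPreserves_PS, fun h hE => empty_notMem_PS ?_⟩
    -- If `E` were piecewise syndetic, then so would be `E \ E = ∅`.
    simpa using h E hE
  · refine ⟨fun h => (removalPreserves_PS h).dual, fun h hE => ?_⟩
    have huniv : Set.univ ∈ dual PS := fun A hA => by
      rw [Set.univ_inter]
      refine Set.nonempty_iff_ne_empty.2 ?_
      rintro rfl
      exact empty_notMem_PS hA
    obtain ⟨n, hn, hnE⟩ := h _ huniv E hE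
    exact hn.2 hnE
  · intro h
    have hcS := removalPreserves_dcS h
    have hPS := removalPreserves_dcPS hcS
    exact ⟨hcS, hcS.dual, hPS, hPS.dual⟩
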